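/- Let $\mathfrak g$ be a finite-dimensional complex semisimple Lie algebra with Killing form $K$, let $\mathfrak h$ be a Cartan subalgebra, $\Phi$ the root system of $(\mathfrak g,\mathfrak h)$, and $\Phi^+$ the set of positive roots with respect to a base of $\Phi$, whose elements are the simple roots. For $\alpha\in\Phi$ let $\mathfrak g_\alpha$ be the root space, $H_\alpha\in[\mathfrak g_\alpha,\mathfrak g_{-\alpha}]$ the element with $\alpha(H_\alpha)=2$, and $s_\alpha$ the reflection in $\alpha$. Let $\{E_\alpha\mid\alpha\in\Phi\}\cup\{H_i\}$ be a Chevalley basis of $\mathfrak g$: the $H_i$ are the $H_\alpha$ with $\alpha$ simple, $E_\alpha\in\mathfrak g_\alpha$, $[E_\alpha,E_{-\alpha}]=H_\alpha$ for all $\alpha\in\Phi$, and, writing $[E_\alpha,E_\gamma]=c_{\alpha,\gamma}E_{\alpha+\gamma}$ whenever $\alpha,\gamma,\alpha+\gamma\in\Phi$, one has $c_{\alpha,\gamma}=-c_{-\alpha,-\gamma}$. Put $\lambda_\alpha=1/K(E_\alpha,E_{-\alpha})$ and $$\pi=\sum_{\alpha\in\Phi^+}\lambda_\alpha\,E_\alpha\wedge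 E_{-\alpha}\in\textstyle\bigwedge^2\mathfrak g .$$ For $x\in\mathfrak g$ let $[x,\cdot\,]$ denote the adjoint action on $\bigwedge^2\mathfrak g$, i.e. the linear map with $[x,a\wedge b]=[x,a]\wedge b+a\wedge[x,b]$. For $w$ in the Weyl group let $\Phi_w=\{\alpha\in\Phi^+\mid w^{-1}\alpha\in-\Phi^+\}$. Call $\beta\in\Phi$ long if no root $\alpha$ in the irreducible component of $\Phi$ containing $\beta$ satisfies $(\alpha,\alpha)>(\beta,\beta)$, where $(\cdot,\cdot)$ is the form on $\mathfrak h^*$ dual to $K|_{\mathfrak h}$. Let $\beta\in\Phi^+$ be a long root. Then $\beta-\alpha$ is a root for every $\alpha\in\Phi_{s_\beta}$ with $\alpha\neq\beta$, and $$[E_\beta,\pi]=\lambda_\beta\,E_\beta\wedge H_\beta+\sum_{\substack{\alpha\in\Phi_{s_\beta}\\ \alpha\neq\beta}}\lambda_\alpha\,c_{\beta,-\alpha}\,E_\alpha\wedge E_{\beta-\alpha}.$$ -/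

import Mathlib

open Module LieAlgebra LieAlgebra.IsKilling
open scoped BigOperators

noncomputable section

namespace LongRootBracket

section Wedge

theorem update_zero {X : Type*} (a b c : X) : Function.update ![a, b] 0 c = ![c, b] := by
  funext k; fin_cases k <;> rfl

theorem update_one {X : Type*} (a b c : X) : Function.update ![a, b] 1 c = ![a, c] := by
  funext k; fin_cases k <;> rfl

variable {L : Type*} [LieRing L] [LieAlgebra ℂ L]

/-- The decomposable bivector `a ∧ b` in `⋀² L`. -/
def wedge (a b : L) : ⋀[ℂ]^2 L := exteriorPower.ιMulti ℂ 2 ![a, b]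

theorem wedge_add_left (a a' b : L) : wedge (a + a') b = wedge a b + wedge a' b := by
  have h := (exteriorPower.ιMulti ℂ 2).map_update_add ![a, b] 0 a a'
  rw [update_zero, update_zero] at h
  exact h

theorem wedge_add_right (a b b' : L) : wedge a (b + b') = wedge a b + wedge a b' := by
  have h := (exteriorPower.ιMulti ℂ 2).map_update_add ![a, b] 1 b b'
  rw [update_one, update_one] at h
  exact h

theorem wedge_smul_left (c : ℂ) (a b : L) : wedge (c • a) b = c • wedge a b := by
  have h := (exteriorPower.ιMulti ℂ 2).map_update_smul ![a, b] 0 c a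
  rw [update_zero, update_zero] at h
  exact h

theorem wedge_smul_right (c : ℂ) (a b : L) : wedge a (c • b) = c • wedge a b := by
  have h := (exteriorPower.ιMulti ℂ 2).map_update_smul ![a, b] 1 c b
  rw [update_one, update_one] at h
  exact h

theorem wedge_self (a : L) : wedge a a = 0 :=
  (exteriorPower.ιMulti ℂ 2).map_eq_zero_of_eq ![a, a] (i := 0) (j := 1) rfl (by decide)

theorem wedge_swap (a b : L) : wedge a b = -wedge b a := by
  have h := wedge_self (a + b)
  rw [wedge_add_left, wedge_add_right, wedge_add_right, wedge_self, wedge_self, zero_add,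
    add_zero] at h
  exact eq_neg_of_add_eq_zero_left h

/-- The alternating map `(a, b) ↦ [x, a] ∧ b + a ∧ [x, b]`. -/
def adWedgeAux (x : L) : L [⋀^Fin 2]→ₗ[ℂ] ⋀[ℂ]^2 L where
  toFun v := wedge ⁅x, v 0⁆ (v 1) + wedge (v 0) ⁅x, v 1⁆
  map_update_add' := by
    intro _ v i p q
    fin_cases i <;> simp [wedge_add_left, wedge_add_right] <;> abel
  map_update_smul' := by
    intro _ v i c p
    fin_cases i <;> simp [wedge_smul_left, wedge_smul_right]
  map_eq_zero_of_eq' := by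
    intro v i j hv hij
    have h : v 0 = v 1 := by
      fin_cases i <;> fin_cases j <;> simp_all
    rw [h, wedge_swap (v 1), add_neg_cancel]

/-- The bracket `[x, ·]` on bivectors, i.e. the adjoint action of `x ∈ L` on `⋀² L`: the linear
map with `[x, a ∧ b] = [x, a] ∧ b + a ∧ [x, b]`. -/
def adWedge (x : L) : ⋀[ℂ]^2 L →ₗ[ℂ] ⋀[ℂ]^2 L :=
  exteriorPower.alternatingMapLinearEquiv (adWedgeAux x)

theorem adWedge_wedge (x a b : L) :
    adWedge x (wedge a b) = wedge ⁅x, a⁆ b + wedge a ⁅x, b⁆ := by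
  simp [adWedge, wedge, adWedgeAux]

end Wedge

variable {L : Type*} [LieRing L] [LieAlgebra ℂ L] [FiniteDimensional ℂ L]
  [LieAlgebra.IsSemisimple ℂ L] {H : LieSubalgebra ℂ L} [H.IsCartanSubalgebra]

/-- The bilinear form on `H*` dual to the Killing form: `(μ, ν) = K(t_μ, t_ν)`, where `t_μ ∈ H` is
determined by `μ(h) = K(t_μ, h)` for all `h ∈ H`. -/
def dualForm (μ ν : Dual ℂ H) : ℂ :=
  killingForm ℂ L ((cartanEquivDual H).symm μ : H) ((cartanEquivDual H).symm ν : H)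

/-- Two roots lie in the same irreducible component of the root system: they are joined by a chain
of roots in which consecutive ones are not orthogonal. -/
def SameComponent (α γ : H.root) : Prop :=
  Relation.ReflTransGen
    (fun δ ε : H.root => dualForm ((rootSystem H).root δ) ((rootSystem H).root ε) ≠ 0) α γ

/-- A root `β` is long if no root in its irreducible component is strictly longer. (The numbers
`(α, α)`, `α` a root, are positive rationals; they are compared through their real parts.) -/
def IsLongRoot (β : H.root) : Prop :=
  ¬ ∃ α : H.root, SameComponent β α ∧
    (dualForm ((rootSystem H).root β) ((rootSystem H).root β)).re <
      (dualForm ((rootSystem H).root α) ((rootSystem H).root α)).re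

open Classical in
/-- The set `Φ⁺` of positive roots with respect to a base. -/
def posRoots (b : (rootSystem H).Base) : Finset H.root :=
  Finset.univ.filter fun α => b.IsPos α

open Classical in
/-- `Φ_w`, the set of positive roots `α` such that `w⁻¹ α` is a negative root. -/
def inversionSet (b : (rootSystem H).Base) (w : (rootSystem H).weylGroup) : Finset H.root :=
  (posRoots b).filter fun α =>
    ∃ γ ∈ posRoots b, w⁻¹ • (rootSystem H).root α = -(rootSystem H).root γ

section Basis

variable {b : (rootSystem H).Base} (B : Basis (H.root ⊕ b.support) ℂ L)

open Classical in
/-- Given a basis `B` of `L` indexed by the roots and the simple roots, `rootVec B μ` is the basis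
vector `E_μ` attached to the root `μ`, a functional on `H`; it is `0` if `μ` is not a root. -/
def rootVec (μ : Dual ℂ H) : L :=
  if h : ∃ α : H.root, (rootSystem H).root α = μ then B (Sum.inl h.choose) else 0

theorem rootVec_root (α : H.root) : rootVec B ((rootSystem H).root α) = B (Sum.inl α) := by
  have h : ∃ γ : H.root, (rootSystem H).root γ = (rootSystem H).root α := ⟨α, rfl⟩
  rw [rootVec, dif_pos h, (rootSystem H).root.injective h.choose_spec]

open Classical in
/-- The structure constant `c_{μ,ν}` for roots `μ, ν` such that `μ + ν` is a root: the coefficient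
of `E_{μ+ν}` in the expansion of `[E_μ, E_ν]`; it is `0` if `μ + ν` is not a root. -/
def structConst (μ ν : Dual ℂ H) : ℂ :=
  if h : ∃ α : H.root, (rootSystem H).root α = μ + ν then
    B.repr ⁅rootVec B μ, rootVec B ν⁆ (Sum.inl h.choose) else 0

/-- `B = {E_α} ∪ {H_i}` is a Chevalley basis of `L` with respect to the Cartan subalgebra `H` and
the base `b` of the root system. -/
structure IsChevalleyBasis : Prop where
  mem_rootSpace (α : H.root) : B (Sum.inl α) ∈ rootSpace H (α : LieModule.Weight ℂ H L)
  eq_coroot (i : b.support) : B (Sum.inr i) = ((rootSystem H).coroot i : L)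
  lie_neg (α : H.root) :
    ⁅rootVec B ((rootSystem H).root α), rootVec B (-(rootSystem H).root α)⁆ =
      ((rootSystem H).coroot α : L)
  structConst_neg (α γ δ : H.root)
    (h : (rootSystem H).root α + (rootSystem H).root γ = (rootSystem H).root δ) :
    structConst B ((rootSystem H).root α) ((rootSystem H).root γ) =
      -structConst B (-(rootSystem H).root α) (-(rootSystem H).root γ)

/-- `λ_μ = 1 / K(E_μ, E_{-μ})`. -/
def lam (μ : Dual ℂ H) : ℂ := 1 / killingForm ℂ L (rootVec B μ) (rootVec B (-μ))

/-- `π = ∑_{α > 0} λ_α E_α ∧ E_{-α}`. -/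
def piBivector : ⋀[ℂ]^2 L :=
  ∑ α ∈ posRoots b, lam B ((rootSystem H).root α) •
    wedge (rootVec B ((rootSystem H).root α)) (rootVec B (-(rootSystem H).root α))

end Basis

end LongRootBracket

end

namespace LongRootBracket

variable {L : Type*} [LieRing L] [LieAlgebra ℂ L] [FiniteDimensional ℂ L]
  [LieAlgebra.IsSemisimple ℂ L] {H : LieSubalgebra ℂ L} [H.IsCartanSubalgebra]

/-! ### Pairings with a long root -/

section LongRoots

/-! Expanding `[E_β, π]` gives, for each positive `α`, a left term `λ_α [E_β, E_α] ∧ E_{-α}` and a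
right term `λ_α E_α ∧ [E_β, E_{-α}]`. Invariance of the Killing form makes the left term at `α`
cancel the right term at `β + α` when that is a root (`lam_smul_wedge_lie_eq_neg`); otherwise the
left term is zero. What survives is the right terms at those `δ` for which `δ - β` is not a positive
root: `δ = β` yields `H_β`, and any other `δ` contributes only if `β - δ` is a positive root.

Length enters only in identifying these last `δ` with the inversion set of `s_β` minus `β`
(`mem_erase_inversionSet_iff`): for `β` long, `⟨α, β^∨⟩` lies in `{-1, 0, 1}` unless `α = ±β`, so
`s_β` moves `α` by at most one copy of `β`. -/

theorem dualForm_eq_apply (μ ν : Dual ℂ H) :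
    dualForm μ ν = μ ((cartanEquivDual H).symm ν) := by
  have h : cartanEquivDual H ((cartanEquivDual H).symm μ) ((cartanEquivDual H).symm ν) =
      μ ((cartanEquivDual H).symm ν) := by rw [LinearEquiv.apply_symm_apply]
  exact h

theorem dualForm_comm (μ ν : Dual ℂ H) : dualForm μ ν = dualForm ν μ :=
  LieModule.traceForm_comm ℂ L L _ _

theorem dualForm_root_self_ne_zero (α : H.root) :
    dualForm ((rootSystem H).root α) ((rootSystem H).root α) ≠ 0 := by
  rw [dualForm_eq_apply]
  exact root_apply_cartanEquivDual_symm_ne_zero (H.isNonZero_coe_root α)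

theorem pairing_mul_dualForm (α γ : H.root) :
    (rootSystem H).pairing α γ * dualForm ((rootSystem H).root γ) ((rootSystem H).root γ) =
      2 * dualForm ((rootSystem H).root α) ((rootSystem H).root γ) := by
  have h0 := dualForm_root_self_ne_zero γ
  have h : (rootSystem H).pairing α γ =
      2 * ((dualForm ((rootSystem H).root γ) ((rootSystem H).root γ))⁻¹ *
        dualForm ((rootSystem H).root α) ((rootSystem H).root γ)) := by
    rw [dualForm_eq_apply, dualForm_eq_apply, rootSystem_pairing_apply, coroot,
      ← LieModule.Weight.toLinear_apply, map_nsmul, map_smul, nsmul_eq_mul, smul_eq_mul]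
    rfl
  rw [h]
  field_simp

/-- The trace form gives `K(H_γ, H_γ) = 4 / (γ, γ)`, and it is also the sum of the squared integers
`⟨α, γ^∨⟩` over all roots `α`. Hence `(γ, γ) = 4 / N` with `N` a positive integer. -/
theorem dualForm_root_self_re_pos (γ : H.root) :
    0 < (dualForm ((rootSystem H).root γ) ((rootSystem H).root γ)).re := by
  have h0 := dualForm_root_self_ne_zero γ
  set q := dualForm ((rootSystem H).root γ) ((rootSystem H).root γ) with hq
  have h1 : (rootSystem H).CorootForm ((rootSystem H).coroot γ) ((rootSystem H).coroot γ) =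
      4 * q⁻¹ := by
    have h2 : LieModule.traceForm ℂ H L (coroot (γ : LieModule.Weight ℂ H L))
        (coroot (γ : LieModule.Weight ℂ H L)) = 4 * q⁻¹ := by
      rw [traceForm_coroot, root_apply_coroot (H.isNonZero_coe_root γ), hq, dualForm_eq_apply,
        nsmul_eq_mul, smul_eq_mul, ← LieModule.Weight.toLinear_apply]
      simp only [rootSystem_root_apply]
      push_cast
      ring
    rw [corootForm_rootSystem_eq_killing]
    exact h2
  set N : ℤ := ∑ i, (rootSystem H).pairingIn ℤ i γ * (rootSystem H).pairingIn ℤ i γ with hN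
  have h3 : (N : ℂ) = 4 * q⁻¹ := by
    rw [← h1, RootPairing.corootForm_apply_apply, hN]
    push_cast
    refine Finset.sum_congr rfl fun i _ ↦ ?_
    have : (((rootSystem H).pairingIn ℤ i γ : ℤ) : ℂ) = (rootSystem H).pairing i γ :=
      (rootSystem H).algebraMap_pairingIn ℤ i γ
    rw [this]
    rfl
  have hN0 : 0 ≤ N := Finset.sum_nonneg fun i _ ↦ mul_self_nonneg _
  have hq' : q = ((4 / (N : ℝ) : ℝ) : ℂ) := by
    push_cast
    rw [h3]
    field_simp
  have hN1 : N ≠ 0 := by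
    intro h
    apply h0
    rw [hq', h]
    simp
  rw [hq', Complex.ofReal_re]
  have : 0 < (N : ℝ) := by exact_mod_cast lt_of_le_of_ne hN0 hN1.symm
  positivity

/-- Since `⟨β, α^∨⟩ (α, α) = ⟨α, β^∨⟩ (β, β)`, a pairing `⟨α, β^∨⟩` equal to `±2` or `±3` forces
`⟨β, α^∨⟩ = ±1` with the same sign, so `α` is strictly longer than `β`. It is not orthogonal to `β`,
hence lies in the same component. -/
theorem IsLongRoot.abs_pairingIn_le_one {α β : H.root} (hβ : IsLongRoot β)
    (h : (rootSystem H).root α ≠ (rootSystem H).root β)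
    (h' : (rootSystem H).root α ≠ -(rootSystem H).root β) :
    |(rootSystem H).pairingIn ℤ α β| ≤ 1 := by
  by_contra hlt
  have hmem := (rootSystem H).pairingIn_pairingIn_mem_set_of_isCrystal_of_isRed' α β h h'
  have hα := pairing_mul_dualForm α β
  have hβα := pairing_mul_dualForm β α
  rw [dualForm_comm ((rootSystem H).root β), ← hα, ← (rootSystem H).algebraMap_pairingIn ℤ,
    ← (rootSystem H).algebraMap_pairingIn ℤ] at hβα
  rw [← (rootSystem H).algebraMap_pairingIn ℤ] at hα
  have hq := dualForm_root_self_ne_zero β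
  have hpos := dualForm_root_self_re_pos β
  apply hβ
  refine ⟨α, Relation.ReflTransGen.single fun h0 ↦ ?_, ?_⟩
  · rw [dualForm_comm ((rootSystem H).root α), h0, mul_zero, mul_eq_zero] at hα
    have : (rootSystem H).pairingIn ℤ α β = 0 := by
      simpa using hα.resolve_right hq
    simp [this] at hlt
  · replace hβα := congrArg Complex.re hβα
    simp only [algebraMap_int_eq, eq_intCast, Complex.mul_re, Complex.intCast_re,
      Complex.intCast_im, zero_mul, sub_zero] at hβα
    simp only [Set.mem_insert_iff, Set.mem_singleton_iff, Prod.mk.injEq] at hmem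
    rcases hmem with h | h | h | h | h | h | h | h | h | h | h <;>
      rw [h.1] at hlt hβα <;> rw [h.2] at hβα <;> push_cast at hβα <;>
        norm_num at hlt <;> linarith

end LongRoots

/-! ### Positive roots and the inversion set of a long reflection -/

section PositiveRoots

theorem exists_root_neg (α : H.root) :
    ∃ γ : H.root, (rootSystem H).root γ = -(rootSystem H).root α :=
  ⟨_, ((rootSystem H).root_reflectionPerm α α).trans (RootPairing.reflection_apply_self ..)⟩

variable {b : (rootSystem H).Base}

theorem not_isPos_of_root_eq_neg {α γ : H.root} (hα : b.IsPos α)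
    (h : (rootSystem H).root γ = -(rootSystem H).root α) : ¬ b.IsPos γ := by
  have hγ : γ = (rootSystem H).reflectionPerm α α := by
    apply (rootSystem H).root.injective
    rw [h, RootPairing.root_reflectionPerm, RootPairing.reflection_apply_self]
  -- Height changes sign under negation, and a root is positive exactly when its height is.
  have := b.height_reflectionPerm_self α
  rw [RootPairing.Base.isPos_iff] at hα ⊢
  intro h1
  rw [hγ] at h1
  change 0 < b.height (@Neg.neg _ (rootSystem H).indexNeg.toNeg α) at h1
  lia

theorem exists_isPos_root_eq_neg {α : H.root} (hα : ¬ b.IsPos α) :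
    ∃ γ, b.IsPos γ ∧ (rootSystem H).root γ = -(rootSystem H).root α := by
  refine ⟨(rootSystem H).reflectionPerm α α, (RootPairing.Base.IsPos.or_neg b α).resolve_left hα,
    ?_⟩
  rw [RootPairing.root_reflectionPerm, RootPairing.reflection_apply_self]

theorem mem_posRoots {α : H.root} : α ∈ posRoots b ↔ b.IsPos α := by
  simp [posRoots]

theorem ofIdx_inv_smul (β : H.root) (x : Dual ℂ H) :
    (RootPairing.weylGroup.ofIdx (rootSystem H) β)⁻¹ • x = (rootSystem H).reflection β x := by
  rw [inv_smul_eq_iff, RootPairing.weylGroup.ofIdx_smul]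
  change x = (rootSystem H).reflection β ((rootSystem H).reflection β x)
  simp

/-- The inversion set of the reflection in a long positive root `β` consists of `β` and the
positive roots `α` for which `β - α` is a positive root. -/
theorem IsLongRoot.mem_erase_inversionSet_iff {β : H.root} (hβ : IsLongRoot β) (hpos : b.IsPos β)
    {α : H.root} [DecidableEq H.root] :
    α ∈ (inversionSet b (RootPairing.weylGroup.ofIdx (rootSystem H) β)).erase β ↔
      b.IsPos α ∧ ∃ γ, b.IsPos γ ∧
        (rootSystem H).root γ = (rootSystem H).root β - (rootSystem H).root α := by
  simp only [inversionSet, Finset.mem_erase, Finset.mem_filter, mem_posRoots, ofIdx_inv_smul,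
    RootPairing.reflection_apply_root' ℤ]
  constructor
  · rintro ⟨hne, hα, γ, hγ, h⟩
    refine ⟨hα, γ, hγ, ?_⟩
    have hle := hβ.abs_pairingIn_le_one (α := α) (fun h ↦ hne ((rootSystem H).root.injective h))
      (fun h ↦ not_isPos_of_root_eq_neg hpos h hα)
    rw [abs_le] at hle
    obtain h0 | h0 | h0 : (rootSystem H).pairingIn ℤ α β = -1 ∨
      (rootSystem H).pairingIn ℤ α β = 0 ∨ (rootSystem H).pairingIn ℤ α β = 1 := by lia
    -- Here `s_β α = α + β` would be a negative root, yet it is a sum of positive roots.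
    · rw [h0] at h
      obtain ⟨δ, hδ⟩ := exists_root_neg γ
      refine absurd (hα.add hpos (k := δ) ?_) (not_isPos_of_root_eq_neg hγ hδ)
      rw [hδ, ← h]
      module
    · rw [h0, zero_smul, sub_zero] at h
      exact absurd hα (not_isPos_of_root_eq_neg hγ h)
    · rw [h0, one_smul] at h
      rw [← neg_sub, h, neg_neg]
  · rintro ⟨hα, γ, hγ, h⟩
    have hαβ : (rootSystem H).root α ≠ (rootSystem H).root β := by
      intro h'
      rw [h', sub_self] at h
      exact (rootSystem H).ne_zero γ h
    have hγβ : (rootSystem H).root γ ≠ (rootSystem H).root β := by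
      intro h'
      rw [h', eq_comm, sub_eq_self] at h
      exact (rootSystem H).ne_zero α h
    have h1 := hβ.abs_pairingIn_le_one hαβ (fun h ↦ not_isPos_of_root_eq_neg hpos h hα)
    have h2 := hβ.abs_pairingIn_le_one hγβ (fun h ↦ not_isPos_of_root_eq_neg hpos h hγ)
    -- The pairings of `α` and `γ` with `β^∨` sum to `⟨β, β^∨⟩ = 2`; both being at most `1`, each
    -- equals `1`.
    have h3 : (rootSystem H).pairingIn ℤ γ β = 2 - (rootSystem H).pairingIn ℤ α β := by
      apply (algebraMap ℤ ℂ).injective_int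
      rw [map_sub, RootPairing.algebraMap_pairingIn, RootPairing.algebraMap_pairingIn,
        ← RootPairing.root_coroot_eq_pairing, h, map_sub, LinearMap.sub_apply,
        RootPairing.root_coroot_eq_pairing, RootPairing.root_coroot_eq_pairing,
        RootPairing.pairing_same]
      simp
    have h4 : (rootSystem H).pairingIn ℤ α β = 1 := by
      rw [h3] at h2
      rw [abs_le] at h1 h2
      lia
    refine ⟨fun h ↦ hαβ (by rw [h]), hα, γ, hγ, ?_⟩
    rw [h4, h]
    module

end PositiveRoots

/-! ### Brackets of root vectors and invariance of the Killing form -/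

section Brackets

variable {b : (rootSystem H).Base} {B : Basis (H.root ⊕ b.support) ℂ L}

theorem rootVec_ne_zero (α : H.root) : rootVec B ((rootSystem H).root α) ≠ 0 := by
  rw [rootVec_root]
  exact B.ne_zero _

theorem exists_root_eq_of_rootSpace_ne_bot {μ : Dual ℂ H} (hμ : μ ≠ 0)
    (h : rootSpace H (μ : H → ℂ) ≠ ⊥) : ∃ δ : H.root, (rootSystem H).root δ = μ := by
  let w : LieModule.Weight ℂ H L := ⟨μ, h⟩
  have hw : w.IsNonZero := fun h0 ↦ hμ (DFunLike.coe_injective h0)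
  exact ⟨⟨w, by simpa using hw⟩, rfl⟩

namespace IsChevalleyBasis

theorem rootVec_mem (hB : IsChevalleyBasis B) (α : H.root) :
    rootVec B ((rootSystem H).root α) ∈ rootSpace H ((rootSystem H).root α : H → ℂ) := by
  rw [rootVec_root]
  exact hB.mem_rootSpace α

theorem lie_rootVec_mem (hB : IsChevalleyBasis B) (α γ : H.root) :
    ⁅rootVec B ((rootSystem H).root α), rootVec B ((rootSystem H).root γ)⁆ ∈
      rootSpace H (((rootSystem H).root α + (rootSystem H).root γ : Dual ℂ H) : H → ℂ) :=
  lie_mem_genWeightSpace_of_mem_genWeightSpace (hB.rootVec_mem α) (hB.rootVec_mem γ)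

/-- Root spaces are one-dimensional, so the bracket has no other component. -/
theorem lie_rootVec (hB : IsChevalleyBasis B) {α γ δ : H.root}
    (h : (rootSystem H).root δ = (rootSystem H).root α + (rootSystem H).root γ) :
    ⁅rootVec B ((rootSystem H).root α), rootVec B ((rootSystem H).root γ)⁆ =
      structConst B ((rootSystem H).root α) ((rootSystem H).root γ) •
        rootVec B ((rootSystem H).root δ) := by
  have hmem := hB.lie_rootVec_mem α γ
  rw [← h] at hmem
  have h1 := finrank_rootSpace_eq_one (δ : LieModule.Weight ℂ H L) (H.isNonZero_coe_root δ)
  obtain ⟨c, hc⟩ := (finrank_eq_one_iff_of_nonzero'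
    (⟨_, hB.rootVec_mem δ⟩ : rootSpace H ((rootSystem H).root δ : H → ℂ))
    (fun h0 ↦ rootVec_ne_zero (B := B) δ (congrArg Subtype.val h0))).mp h1 ⟨_, hmem⟩
  replace hc : c • rootVec B ((rootSystem H).root δ) =
      ⁅rootVec B ((rootSystem H).root α), rootVec B ((rootSystem H).root γ)⁆ :=
    congrArg Subtype.val hc
  have hex : ∃ ε : H.root, (rootSystem H).root ε =
      (rootSystem H).root α + (rootSystem H).root γ := ⟨δ, h⟩
  have hδ : hex.choose = δ := (rootSystem H).root.injective (hex.choose_spec.trans h.symm)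
  have hs : structConst B ((rootSystem H).root α) ((rootSystem H).root γ) = c := by
    rw [structConst, dif_pos hex, hδ, ← hc, rootVec_root, map_smul, Finsupp.smul_apply,
      Basis.repr_self, Finsupp.single_eq_same, smul_eq_mul, mul_one]
  rw [hs, hc]

theorem lie_rootVec_eq_zero (hB : IsChevalleyBasis B) {α γ : H.root}
    (h0 : (rootSystem H).root α + (rootSystem H).root γ ≠ 0)
    (h : ¬ ∃ δ : H.root, (rootSystem H).root δ =
      (rootSystem H).root α + (rootSystem H).root γ) :
    ⁅rootVec B ((rootSystem H).root α), rootVec B ((rootSystem H).root γ)⁆ = 0 := by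
  have hbot : rootSpace H (((rootSystem H).root α + (rootSystem H).root γ : Dual ℂ H) :
      H → ℂ) = ⊥ :=
    by_contra fun hne ↦ h (exists_root_eq_of_rootSpace_ne_bot h0 hne)
  have := hB.lie_rootVec_mem α γ
  rwa [hbot, LieSubmodule.mem_bot] at this

/-- The bracket `[E_α, E_{-α}] = H_α` is `K(E_α, E_{-α})` times a vector, and `H_α ≠ 0`. -/
theorem killingForm_rootVec_ne_zero (hB : IsChevalleyBasis B) (α : H.root) :
    killingForm ℂ L (rootVec B ((rootSystem H).root α))
      (rootVec B (-(rootSystem H).root α)) ≠ 0 := by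
  intro h0
  obtain ⟨γ, hγ⟩ := exists_root_neg α
  have hm := hB.rootVec_mem γ
  rw [hγ] at hm
  have h := lie_eq_killingForm_smul_of_mem_rootSpace_of_mem_rootSpace_neg
    (α := (α : LieModule.Weight ℂ H L)) (hB.rootVec_mem α) hm
  rw [hB.lie_neg, h0, zero_smul] at h
  exact (rootSystem H).flip.ne_zero α (Subtype.val_injective h)

/-- Invariance of the Killing form, in terms of structure constants: if `δ = β + α` then
`λ_α c_{β,α} = -λ_δ c_{β,-δ}`. -/
theorem lam_mul_structConst (hB : IsChevalleyBasis B) {α β δ : H.root}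
    (h : (rootSystem H).root δ = (rootSystem H).root β + (rootSystem H).root α) :
    lam B ((rootSystem H).root α) *
        structConst B ((rootSystem H).root β) ((rootSystem H).root α) =
      -(lam B ((rootSystem H).root δ) *
        structConst B ((rootSystem H).root β) (-(rootSystem H).root δ)) := by
  obtain ⟨α', hα'⟩ := exists_root_neg α
  obtain ⟨δ', hδ'⟩ := exists_root_neg δ
  have h' : (rootSystem H).root α' = (rootSystem H).root β + (rootSystem H).root δ' := by
    rw [hα', hδ', h]
    module
  have hα := hB.killingForm_rootVec_ne_zero α
  have hδ := hB.killingForm_rootVec_ne_zero δ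
  -- `K([E_β, E_α], E_{-δ}) = -K(E_α, [E_β, E_{-δ}])`; both brackets are multiples of single root
  -- vectors.
  have hinv := LieModule.traceForm_apply_lie_apply' ℂ L L (rootVec B ((rootSystem H).root β))
    (rootVec B ((rootSystem H).root α)) (rootVec B ((rootSystem H).root δ'))
  rw [hB.lie_rootVec h, hB.lie_rootVec h', map_smul, map_smul, LinearMap.smul_apply, hα', hδ',
    smul_eq_mul, smul_eq_mul] at hinv
  change _ * killingForm ℂ L _ _ = -(_ * killingForm ℂ L _ _) at hinv
  rw [lam, lam]
  field_simp
  linear_combination hinv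

/-- The two terms of `[E_β, π]` attached to the positive roots `α` and `δ = β + α` cancel. -/
theorem lam_smul_wedge_lie_eq_neg (hB : IsChevalleyBasis B) {α β δ : H.root}
    (h : (rootSystem H).root δ = (rootSystem H).root β + (rootSystem H).root α) :
    lam B ((rootSystem H).root α) •
        wedge ⁅rootVec B ((rootSystem H).root β), rootVec B ((rootSystem H).root α)⁆
          (rootVec B (-(rootSystem H).root α)) =
      -(lam B ((rootSystem H).root δ) •
        wedge (rootVec B ((rootSystem H).root δ))
          ⁅rootVec B ((rootSystem H).root β), rootVec B (-(rootSystem H).root δ)⁆) := by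
  obtain ⟨α', hα'⟩ := exists_root_neg α
  obtain ⟨δ', hδ'⟩ := exists_root_neg δ
  have h' : (rootSystem H).root α' = (rootSystem H).root β + (rootSystem H).root δ' := by
    rw [hα', hδ', h]
    module
  have hlam := hB.lam_mul_structConst h
  rw [← hδ'] at hlam ⊢
  rw [hB.lie_rootVec h, hB.lie_rootVec h', hα', wedge_smul_left, wedge_smul_right, smul_smul,
    smul_smul, hlam, neg_smul]

end IsChevalleyBasis

end Brackets

end LongRootBracket

/-! ### Cancellation in the expansion of the bracket -/

open Classical in
theorem mainTheorem4 {L : Type*} [LieRing L] [LieAlgebra ℂ L] [FiniteDimensional ℂ L]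
    [LieAlgebra.IsSemisimple ℂ L] (H : LieSubalgebra ℂ L) [H.IsCartanSubalgebra]
    (b : (rootSystem H).Base) (B : Basis (H.root ⊕ b.support) ℂ L)
    (hB : LongRootBracket.IsChevalleyBasis B)
    (β : H.root) (hpos : b.IsPos β) (hlong : LongRootBracket.IsLongRoot β) :
    (∀ α ∈ (LongRootBracket.inversionSet b
        (RootPairing.weylGroup.ofIdx (rootSystem H) β)).erase β,
      ∃ γ : H.root, (rootSystem H).root γ = (rootSystem H).root β - (rootSystem H).root α) ∧
    LongRootBracket.adWedge (LongRootBracket.rootVec B ((rootSystem H).root β))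
        (LongRootBracket.piBivector B) =
      LongRootBracket.lam B ((rootSystem H).root β) •
        LongRootBracket.wedge (LongRootBracket.rootVec B ((rootSystem H).root β))
          ((rootSystem H).coroot β : L) +
      ∑ α ∈ (LongRootBracket.inversionSet b
          (RootPairing.weylGroup.ofIdx (rootSystem H) β)).erase β,
        (LongRootBracket.lam B ((rootSystem H).root α) *
          LongRootBracket.structConst B ((rootSystem H).root β) (-(rootSystem H).root α)) •
          LongRootBracket.wedge (LongRootBracket.rootVec B ((rootSystem H).root α))
            (LongRootBracket.rootVec B ((rootSystem H).root β - (rootSystem H).root α)) := by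
  have hmem := fun α ↦ hlong.mem_erase_inversionSet_iff hpos (α := α)
  refine ⟨fun α hα ↦ ((hmem α).mp hα).2.imp fun _ h ↦ h.2, ?_⟩
  open LongRootBracket in
  set I := (inversionSet b (RootPairing.weylGroup.ofIdx (rootSystem H) β)).erase β with hI
  set T : H.root → ⋀[ℂ]^2 L := fun δ ↦ lam B ((rootSystem H).root δ) •
    wedge (rootVec B ((rootSystem H).root δ))
      ⁅rootVec B ((rootSystem H).root β), rootVec B (-(rootSystem H).root δ)⁆ with hT
  -- The sum over `δ` has at most one nonzero term; this form lets the cancellation be done by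
  -- exchanging two sums, with no explicit bijection `α ↦ β + α`.
  have hleft : ∀ α ∈ posRoots b, lam B ((rootSystem H).root α) •
      wedge ⁅rootVec B ((rootSystem H).root β), rootVec B ((rootSystem H).root α)⁆
        (rootVec B (-(rootSystem H).root α)) =
      -∑ δ ∈ posRoots b, if (rootSystem H).root δ =
        (rootSystem H).root β + (rootSystem H).root α then T δ else 0 := by
    intro α hα
    rw [mem_posRoots] at hα
    by_cases h : ∃ δ : H.root, (rootSystem H).root δ =
      (rootSystem H).root β + (rootSystem H).root α
    · obtain ⟨δ, hδ⟩ := h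
      rw [hB.lam_smul_wedge_lie_eq_neg hδ, Finset.sum_eq_single_of_mem δ
        (mem_posRoots.mpr (hpos.add hα hδ)), if_pos hδ]
      intro ε _ hε
      exact if_neg fun h ↦ hε ((rootSystem H).root.injective (h.trans hδ.symm))
    · rw [hB.lie_rootVec_eq_zero _ h, Finset.sum_eq_zero, neg_zero, ← zero_smul ℂ (0 : L),
        wedge_smul_left, zero_smul, smul_zero]
      · intro δ _
        exact if_neg fun h' ↦ h ⟨δ, h'⟩
      · exact fun h0 ↦ not_isPos_of_root_eq_neg hα (eq_neg_of_add_eq_zero_left h0) hpos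
  -- The cases `δ = β`, `β - δ` a positive root and `δ - β` a positive root exclude one another; in
  -- the remaining case `β - δ` is neither zero nor a root, so `T δ = 0`.
  have hright : ∀ δ ∈ posRoots b, T δ = (if δ = β then T δ else 0) + (if δ ∈ I then T δ else 0) +
      ∑ α ∈ posRoots b, if (rootSystem H).root δ =
        (rootSystem H).root β + (rootSystem H).root α then T δ else 0 := by
    intro δ hδ
    rw [mem_posRoots] at hδ
    by_cases h1 : δ = β
    · have h2 : δ ∉ I := by simp [hI, h1]
      rw [if_pos h1, if_neg h2, Finset.sum_eq_zero, add_zero, add_zero]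
      intro α _
      refine if_neg fun h ↦ (rootSystem H).ne_zero α ?_
      rwa [h1, left_eq_add] at h
    · rw [if_neg h1, zero_add]
      by_cases h2 : δ ∈ I
      · rw [if_pos h2, Finset.sum_eq_zero, add_zero]
        intro α hα
        obtain ⟨-, γ, hγ, h⟩ := (hmem δ).mp h2
        refine if_neg fun h' ↦ not_isPos_of_root_eq_neg hγ ?_ (mem_posRoots.mp hα)
        rw [h, h']
        module
      · rw [if_neg h2, zero_add]
        obtain ⟨δ', hδ'⟩ := exists_root_neg δ
        by_cases h : ∃ ε : H.root, (rootSystem H).root ε =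
          (rootSystem H).root β + (rootSystem H).root δ'
        · obtain ⟨ε, hε⟩ := h
          have hε' : ¬ b.IsPos ε := fun hp ↦
            h2 ((hmem δ).mpr ⟨hδ, ε, hp, by rw [hε, hδ', sub_eq_add_neg]⟩)
          obtain ⟨α, hα, hαε⟩ := exists_isPos_root_eq_neg hε'
          have hα' : (rootSystem H).root δ = (rootSystem H).root β + (rootSystem H).root α := by
            rw [hαε, hε, hδ']
            module
          rw [Finset.sum_eq_single_of_mem α (mem_posRoots.mpr hα), if_pos hα']
          intro κ _ hκ
          refine if_neg fun h ↦ hκ ((rootSystem H).root.injective ?_)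
          exact add_left_cancel (h.symm.trans hα')
        · have hT0 : T δ = 0 := by
            simp only [hT]
            rw [← hδ', hB.lie_rootVec_eq_zero _ h, ← zero_smul ℂ (0 : L), wedge_smul_right,
              zero_smul, smul_zero]
            intro h0
            refine h1 ((rootSystem H).root.injective ?_)
            rw [hδ', ← sub_eq_add_neg, sub_eq_zero] at h0
            exact h0.symm
          simp [hT0]
  have hsub : I ⊆ posRoots b := fun α hα ↦ mem_posRoots.mpr ((hmem α).mp hα).1
  have hTI : ∀ α ∈ I, T α = (lam B ((rootSystem H).root α) *
      structConst B ((rootSystem H).root β) (-(rootSystem H).root α)) •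
        wedge (rootVec B ((rootSystem H).root α))
          (rootVec B ((rootSystem H).root β - (rootSystem H).root α)) := by
    intro α hα
    obtain ⟨-, γ, -, hγ⟩ := (hmem α).mp hα
    obtain ⟨α', hα'⟩ := exists_root_neg α
    have h : (rootSystem H).root γ = (rootSystem H).root β + (rootSystem H).root α' := by
      rw [hγ, hα', sub_eq_add_neg]
    simp only [hT]
    rw [← hα', hB.lie_rootVec h, wedge_smul_right, smul_smul, hγ]
  have hTβ : T β = lam B ((rootSystem H).root β) •
      wedge (rootVec B ((rootSystem H).root β)) ((rootSystem H).coroot β : L) := by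
    simp only [hT]
    rw [hB.lie_neg]
  rw [← Finset.sum_congr rfl hTI, ← hTβ, piBivector, map_sum]
  simp only [map_smul, adWedge_wedge, smul_add, Finset.sum_add_distrib]
  -- After `Finset.sum_comm` the double sum from the left terms is the negative of the one from the
  -- right terms.
  rw [Finset.sum_congr rfl hleft, Finset.sum_congr rfl hright, Finset.sum_add_distrib,
    Finset.sum_add_distrib, Finset.sum_neg_distrib, Finset.sum_comm, neg_add_cancel_comm_assoc,
    Finset.sum_ite_eq' _ β, if_pos (mem_posRoots.mpr hpos), Finset.sum_ite_mem,
    Finset.inter_eq_right.mpr hsub]
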